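/- For a set $X$ and a collection $\mathcal H$ of functions $X\to\{0,1\}$, say that $\mathcal H$ shatters a finite set $C\subset X$ if every function $C\to\{0,1\}$ is the restriction to $C$ of some member of $\mathcal H$; a non-negative integer $n$ is the VC-dimension of $\mathcal H$ if some set of exactly $n$ points of $X$ is shattered by $\mathcal H$ and no set of exactly $n+1$ points of $X$ is. For $E\subset\mathbb R^2$ and $t>0$ let $\mathcal H_t^2(E)=\{h_y : y\in E\}$, where $h_y : E\to\{0,1\}$ is given by $h_y(x)=1$ if $|x-y|=t$ (Euclidean norm) and $h_y(x)=0$ otherwise. There exists a compact set $E\subset\mathbb R^2$ of Hausdorff dimension $2$ such that for every $t>0$ the VC-dimension of $\mathcal H_t^2(E)$ is at most $2$. -/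

import Mathlib

/-- A collection `H` of functions from `X` to `{0, 1}` shatters the finite set `C ⊆ X` if the
restrictions to `C` of the members of `H` are all the functions from `C` to `{0, 1}`. -/
def HypothesisShatters {X : Type*} (H : Set (X → Fin 2)) (C : Finset X) : Prop :=
  ∀ f : C → Fin 2, ∃ h ∈ H, ∀ x : C, h x = f x

/-- The natural number `n` is the VC-dimension of `H`: some set of exactly `n` points is shattered
by `H`, and no set of exactly `n + 1` points is. -/
def IsVCDimension {X : Type*} (H : Set (X → Fin 2)) (n : ℕ) : Prop :=
  (∃ C : Finset X, C.card = n ∧ HypothesisShatters H C) ∧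
    ∀ C : Finset X, C.card = n + 1 → ¬ HypothesisShatters H C

open Classical in
/-- The indicator function, on `E`, of the sphere of radius `t` about the point `y`. -/
noncomputable def sphereIndicator {d : ℕ} (t : ℝ) (E : Set (EuclideanSpace ℝ (Fin d)))
    (y : EuclideanSpace ℝ (Fin d)) : E → Fin 2 :=
  fun x => if ‖(x : EuclideanSpace ℝ (Fin d)) - y‖ = t then 1 else 0

/-- The class of indicator functions on `E` of the spheres of radius `t` with centre in `E`. -/
def sphereClass {d : ℕ} (t : ℝ) (E : Set (EuclideanSpace ℝ (Fin d))) : Set (E → Fin 2) :=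
  {h | ∃ y ∈ E, h = sphereIndicator t E y}

/-!
The set is the square `A × A` of a compact set `A ⊆ ℝ` of Hausdorff dimension one which is a Sidon
set: `a + b = c + d` in `A` only if `a ∈ {c, d}`.

*Why the square works.* If three points `x₁, x₂, x₃` are shattered by circles of radius `t`, some
`y` is at distance `t` from all three, and for each pair of them some `z ≠ y` is at distance `t`
from both points of the pair. In the plane this forces `y + z = xᵢ + xⱼ`
(`add_eq_add_of_norm_sub_eq`). By the Sidon property, in either coordinate `y` agrees with `xᵢ` or
with `xⱼ`. So in either coordinate `y` differs from at most one of the three points; there being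
only two coordinates, `y` equals one of the three points, contradicting `t > 0`
(`not_shatters_three`).

*The Sidon set.* The elements of `A` are the numbers `∑ₖ (4 xₖ + χₖ(x)) sₖ`, where `x` runs through
the digit sequences with `0 ≤ xₖ < 2 ^ (2 k + 1)`, the markers `χₖ(x) ∈ {0, 1}` test for all
possible initial segments of `x`, and `sₖ₋₁ = 16 · 2 ^ (2 k + 1) · sₖ`. The room between the scales
excludes carries, so `a + b = c + d` holds digit by digit and for each marker; if `a` differed from
`c` and `d`, the marker of a sufficiently long initial segment of `a` would refute this
(`sparseValue_sidon`).

*The dimension.* No measure is needed. Sending `∑ₖ (4 xₖ + χₖ(x)) sₖ` to the number with mixed-radix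
digits `x` maps `A` onto a set containing `[0, 1)`. The markers and the room cost a factor
`16 ^ (k + 1)` at level `k`, which is negligible against the scale `2 ^ (- k ^ 2)`, so the map is
Hölder of every exponent `r < 1` (`exists_holder_bound`). Applied in both coordinates it shows
`2 ≤ dimH (A × A) / r` for all `r < 1`.
-/

open Set Filter Topology
open scoped NNReal ENNReal

/-! ### Digit sequences and the two expansions -/

/-- Sequences of digits in which the `k`-th digit ranges over `{0, …, 2 ^ (2 k + 1) - 1}`. The
product of the first `k` digit ranges has size `2 ^ (k ^ 2)`. -/
abbrev DigitSeq : Type := ∀ k : ℕ, Fin (2 ^ (2 * k + 1))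

/-- The value `0` or `1` of the `k`-th test on `x`. Decoding `k` as a pair `(m, p)`, the test asks
whether `p` is the code of the list of the first `m` digits of `x`; as `m ≤ k`, only the digits
before the `k`-th one matter. -/
def marker (k : ℕ) (x : DigitSeq) : ℕ :=
  if Encodable.encode ((List.range k.unpair.1).map fun i => (x i : ℕ)) = k.unpair.2 then 1 else 0

/-- The weight of the `k`-th digit in the gapless expansion `denseValue`. -/
noncomputable def denseWeight (k : ℕ) : ℝ := (1 / 2) ^ ((k + 1) ^ 2)

/-- The weight of the `k`-th digit in the expansion `sparseValue`, in which every level has room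
for a digit sixteen times as large as necessary. -/
noncomputable def sparseWeight (k : ℕ) : ℝ := (1 / 2) ^ ((k + 1) ^ 2 + 4 * (k + 1))

/-- The number in `[0, 1]` with mixed-radix digits `x`. -/
noncomputable def denseValue (x : DigitSeq) : ℝ := ∑' k, (x k : ℝ) * denseWeight k

/-- The digit at level `k` of `sparseValue`: a multiple of four carrying the digit of `x`, plus the
marker. -/
def sparseDigit (k : ℕ) (x : DigitSeq) : ℝ := 4 * (x k : ℝ) + marker k x

/-- The expansion of `x` with wide digit ranges and with a marker inserted at every level. -/
noncomputable def sparseValue (x : DigitSeq) : ℝ := ∑' k, sparseDigit k x * sparseWeight k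

theorem marker_le_one (k : ℕ) (x : DigitSeq) : marker k x ≤ 1 := by
  unfold marker; split_ifs <;> simp

theorem marker_congr {k : ℕ} {x y : DigitSeq} (h : ∀ i < k, x i = y i) :
    marker k x = marker k y := by
  have : (List.range k.unpair.1).map (fun i => (x i : ℕ)) =
      (List.range k.unpair.1).map fun i => (y i : ℕ) :=
    List.map_congr_left fun i hi => by
      rw [h i ((List.mem_range.1 hi).trans_le (Nat.unpair_left_le k))]
  unfold marker
  rw [this]

/-- A sequence different from two others is separated from both by one marker. -/
theorem exists_marker_eq_one {a c d : DigitSeq} (hc : a ≠ c) (hd : a ≠ d) :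
    ∃ k, marker k a = 1 ∧ marker k c = 0 ∧ marker k d = 0 := by
  obtain ⟨i, hi⟩ := Function.ne_iff.1 hc
  obtain ⟨j, hj⟩ := Function.ne_iff.1 hd
  set m := max i j + 1 with hm
  have key : ∀ e : DigitSeq, ∀ l < m, a l ≠ e l →
      marker (Nat.pair m (Encodable.encode ((List.range m).map fun i => (a i : ℕ)))) e = 0 := by
    intro e l hl hne
    unfold marker
    rw [Nat.unpair_pair, if_neg]
    intro h
    have h' := List.map_inj_left.1 (Encodable.encode_injective h) l (List.mem_range.2 hl)
    exact hne (Fin.ext h'.symm)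
  refine ⟨_, ?_, key c i (by omega) hi, key d j (by omega) hj⟩
  unfold marker
  rw [Nat.unpair_pair, if_pos rfl]

theorem digit_le (k : ℕ) (x : DigitSeq) : (x k : ℝ) ≤ 2 ^ (2 * k + 1) - 1 := by
  have h : (x k : ℕ) + 1 ≤ 2 ^ (2 * k + 1) := (x k).2
  have : ((x k : ℕ) : ℝ) + 1 ≤ 2 ^ (2 * k + 1) := by exact_mod_cast h
  linarith

theorem abs_digit_sub_le (k : ℕ) (x y : DigitSeq) :
    |(x k : ℝ) - y k| ≤ 2 ^ (2 * k + 1) - 1 := by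
  have hx := digit_le k x
  have hy := digit_le k y
  have hx0 : (0 : ℝ) ≤ (x k : ℕ) := Nat.cast_nonneg _
  have hy0 : (0 : ℝ) ≤ (y k : ℕ) := Nat.cast_nonneg _
  rw [abs_le]; constructor <;> linarith

theorem sparseDigit_nonneg (k : ℕ) (x : DigitSeq) : 0 ≤ sparseDigit k x := by
  unfold sparseDigit; positivity

theorem sparseDigit_le (k : ℕ) (x : DigitSeq) : sparseDigit k x ≤ 4 * 2 ^ (2 * k + 1) := by
  have h1 := digit_le k x
  have h2 : (marker k x : ℝ) ≤ 1 := by exact_mod_cast marker_le_one k x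
  unfold sparseDigit
  linarith

theorem denseWeight_pos (k : ℕ) : 0 < denseWeight k := by unfold denseWeight; positivity

theorem sparseWeight_pos (k : ℕ) : 0 < sparseWeight k := by unfold sparseWeight; positivity

theorem radix_mul_denseWeight (k : ℕ) :
    2 ^ (2 * k + 1) * denseWeight k = (1 / 2 : ℝ) ^ (k ^ 2) := by
  unfold denseWeight
  rw [show (k + 1) ^ 2 = (2 * k + 1) + k ^ 2 by ring, pow_add (1 / 2 : ℝ), ← mul_assoc,
    ← mul_pow]
  norm_num

theorem radix_mul_sparseWeight (k : ℕ) :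
    16 * 2 ^ (2 * k + 1) * sparseWeight k = (1 / 2 : ℝ) ^ (k ^ 2 + 4 * k) := by
  unfold sparseWeight
  rw [show (k + 1) ^ 2 + 4 * (k + 1) = 4 + (2 * k + 1) + (k ^ 2 + 4 * k) by ring,
    pow_add (1 / 2 : ℝ), ← mul_assoc, pow_add (1 / 2 : ℝ) 4, show (16 : ℝ) = 2 ^ 4 by norm_num,
    mul_mul_mul_comm, ← mul_pow, ← mul_pow]
  norm_num

theorem denseWeight_eq_mul_sparseWeight (k : ℕ) :
    denseWeight k = 16 ^ (k + 1) * sparseWeight k := by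
  unfold denseWeight sparseWeight
  rw [pow_add (1 / 2 : ℝ), mul_left_comm, pow_mul (1 / 2 : ℝ), ← mul_pow]
  norm_num

theorem digit_mul_denseWeight_le (k : ℕ) (x : DigitSeq) :
    (x k : ℝ) * denseWeight k ≤ (1 / 2) ^ k := by
  calc (x k : ℝ) * denseWeight k ≤ 2 ^ (2 * k + 1) * denseWeight k :=
        mul_le_mul_of_nonneg_right (by linarith [digit_le k x]) (denseWeight_pos k).le
    _ = (1 / 2) ^ (k ^ 2) := radix_mul_denseWeight k
    _ ≤ (1 / 2) ^ k :=
        pow_le_pow_of_le_one (by norm_num) (by norm_num) (Nat.le_self_pow two_ne_zero k)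

theorem sparseDigit_mul_sparseWeight_le (k : ℕ) (x : DigitSeq) :
    sparseDigit k x * sparseWeight k ≤ (1 / 2) ^ k := by
  have hw := sparseWeight_pos k
  calc sparseDigit k x * sparseWeight k ≤ 16 * 2 ^ (2 * k + 1) * sparseWeight k := by
        refine mul_le_mul_of_nonneg_right ((sparseDigit_le k x).trans ?_) hw.le
        have : (0 : ℝ) < 2 ^ (2 * k + 1) := by positivity
        linarith
    _ = (1 / 2) ^ (k ^ 2 + 4 * k) := radix_mul_sparseWeight k
    _ ≤ (1 / 2) ^ k := pow_le_pow_of_le_one (by norm_num) (by norm_num) (by nlinarith)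

theorem hasSum_denseValue (x : DigitSeq) :
    HasSum (fun k => (x k : ℝ) * denseWeight k) (denseValue x) :=
  (Summable.of_nonneg_of_le (fun k => mul_nonneg (Nat.cast_nonneg _) (denseWeight_pos k).le)
    (fun k => digit_mul_denseWeight_le k x) summable_geometric_two).hasSum

theorem hasSum_sparseValue (x : DigitSeq) :
    HasSum (fun k => sparseDigit k x * sparseWeight k) (sparseValue x) :=
  (Summable.of_nonneg_of_le (fun k => mul_nonneg (sparseDigit_nonneg k x) (sparseWeight_pos k).le)
    (fun k => sparseDigit_mul_sparseWeight_le k x) summable_geometric_two).hasSum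

theorem continuous_sparseValue : Continuous sparseValue := by
  refine continuous_tsum (fun k => Continuous.mul ?_ continuous_const) summable_geometric_two
    fun k x => ?_
  · -- the digit at level `k` factors through finitely many coordinates
    let r : DigitSeq → (∀ i : Fin (k + 1), Fin (2 ^ (2 * (i : ℕ) + 1))) := fun x i => x i
    have hr : Continuous r := continuous_pi fun i => continuous_apply (i : ℕ)
    have hloc : IsLocallyConstant (fun x => sparseDigit k x) := by
      refine IsLocallyConstant.iff_exists_open _ |>.2 fun x => ?_
      refine ⟨r ⁻¹' {r x}, (isOpen_discrete _).preimage hr, rfl, fun y hy => ?_⟩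
      have h : ∀ i < k + 1, y i = x i := fun i hi => congrFun hy (⟨i, hi⟩ : Fin (k + 1))
      simp only [sparseDigit, h k (Nat.lt_succ_self k),
        marker_congr fun i hi => h i (Nat.lt_succ_of_lt hi)]
    exact hloc.continuous
  · rw [Real.norm_of_nonneg (mul_nonneg (sparseDigit_nonneg k x) (sparseWeight_pos k).le)]
    exact sparseDigit_mul_sparseWeight_le k x

/-! ### The leading term dominates -/

/-- If the coefficients of an expansion are small against the drops of the weights, the sum is
governed by the first nonvanishing coefficient: the remaining terms are dominated by a telescoping
sum. -/
theorem abs_sub_leading_term_le {w D : ℕ → ℝ} {S θ : ℝ} (hw : ∀ l, 0 < w l) (hθ : 0 ≤ θ)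
    (hD : ∀ l, |D (l + 1)| * w (l + 1) ≤ θ * (w l - w (l + 1)))
    (hS : HasSum (fun l => D l * w l) S) {k : ℕ} (hk : ∀ l < k, D l = 0) :
    |S - D k * w k| ≤ θ * w k := by
  have hfin : ∀ m, |∑ l ∈ Finset.range (k + 1 + m), D l * w l - D k * w k| ≤
      θ * (w k - w (k + m)) := by
    intro m
    induction m with
    | zero =>
      rw [add_zero, Finset.sum_range_succ,
        Finset.sum_eq_zero fun l hl => by rw [hk l (Finset.mem_range.1 hl), zero_mul]]
      simp
    | succ m ih =>
      rw [← add_assoc, Finset.sum_range_succ, add_sub_right_comm]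
      refine (abs_add_le _ _).trans ?_
      have h := hD (k + m)
      rw [abs_mul, abs_of_pos (hw _), show k + 1 + m = k + m + 1 by ring]
      rw [show k + 1 + m = k + m + 1 by ring] at ih
      rw [← add_assoc]
      linarith
  have hlim : Tendsto (fun m => |∑ l ∈ Finset.range (k + 1 + m), D l * w l - D k * w k|) atTop
      (𝓝 |S - D k * w k|) := by
    refine ((Tendsto.sub ?_ tendsto_const_nhds).abs)
    exact hS.tendsto_sum_nat.comp (tendsto_atTop_mono (fun m => Nat.le_add_left m _) tendsto_id)
  refine le_of_tendsto' hlim fun m => (hfin m).trans ?_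
  exact mul_le_mul_of_nonneg_left (by linarith [hw (k + m)]) hθ

theorem abs_sub_leading_sparse_le {D : ℕ → ℝ} {S : ℝ} (hD : ∀ l, |D l| ≤ 8 * 2 ^ (2 * l + 1))
    (hS : HasSum (fun l => D l * sparseWeight l) S) {k : ℕ} (hk : ∀ l < k, D l = 0) :
    |S - D k * sparseWeight k| ≤ 8 / 15 * sparseWeight k := by
  refine abs_sub_leading_term_le sparseWeight_pos (by norm_num) (fun l => ?_) hS hk
  have h1 := radix_mul_sparseWeight (l + 1)
  have h2 : sparseWeight l = (1 / 2 : ℝ) ^ ((l + 1) ^ 2 + 4 * (l + 1)) := rfl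
  rw [← h2] at h1
  have hw := sparseWeight_pos (l + 1)
  have h3 : |D (l + 1)| * sparseWeight (l + 1) ≤
      8 * 2 ^ (2 * (l + 1) + 1) * sparseWeight (l + 1) :=
    mul_le_mul_of_nonneg_right (hD (l + 1)) hw.le
  have h4 : 1 * sparseWeight (l + 1) ≤ 2 ^ (2 * (l + 1) + 1) * sparseWeight (l + 1) :=
    mul_le_mul_of_nonneg_right (one_le_pow₀ (by norm_num)) hw.le
  linarith

/-! ### The compact Sidon set -/

/-- A solution of `a + b = c + d` in the values of the sparse expansion is trivial. The digits are
so small that no carries occur, hence the equation holds at every level, modulo four in particular,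
and thus for the markers; but some marker tells `a` from both `c` and `d`. -/
theorem sparseValue_sidon {a b c d : DigitSeq}
    (h : sparseValue a + sparseValue b = sparseValue c + sparseValue d) : a = c ∨ a = d := by
  by_contra! hne
  obtain ⟨k, ha, hc, hd⟩ := exists_marker_eq_one hne.1 hne.2
  let J : ℕ → ℤ := fun l =>
    4 * ((a l : ℕ) + (b l : ℕ) - (c l : ℕ) - (d l : ℕ)) +
      (marker l a + marker l b - marker l c - marker l d)
  let D : ℕ → ℝ := fun l => sparseDigit l a + sparseDigit l b - sparseDigit l c - sparseDigit l d
  have hJD : ∀ l, D l = J l := fun l => by simp only [D, J, sparseDigit]; push_cast; ring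
  have hS : HasSum (fun l => D l * sparseWeight l) 0 := by
    have := (((hasSum_sparseValue a).add (hasSum_sparseValue b)).sub
      (hasSum_sparseValue c)).sub (hasSum_sparseValue d)
    convert! this using 1
    · ext l; simp only [D]; ring
    · linarith
  have hD : ∀ l, |D l| ≤ 8 * 2 ^ (2 * l + 1) := fun l => by
    have := sparseDigit_le l a
    have := sparseDigit_le l b
    have := sparseDigit_le l c
    have := sparseDigit_le l d
    have := sparseDigit_nonneg l a
    have := sparseDigit_nonneg l b
    have := sparseDigit_nonneg l c
    have := sparseDigit_nonneg l d
    simp only [D]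
    rw [abs_le]; constructor <;> linarith
  have hzero : ∀ l, D l = 0 := fun l => by
    induction l using Nat.strong_induction_on with
    | _ l ih =>
      have h1 := abs_sub_leading_sparse_le hD hS ih
      have hw := sparseWeight_pos l
      rw [zero_sub, abs_neg, abs_mul, abs_of_pos hw] at h1
      have h2 : |D l| < 1 := (le_of_mul_le_mul_right h1 hw).trans_lt (by norm_num)
      rw [hJD] at h2 ⊢
      have h3 : |J l| < 1 := by exact_mod_cast h2
      rw [Int.abs_lt_one_iff.1 h3, Int.cast_zero]
  have hJ : J k = 0 := by exact_mod_cast (hJD k).symm.trans (hzero k)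
  have hb := marker_le_one k b
  simp only [J] at hJ
  omega

theorem sparseValue_injective : Function.Injective sparseValue := fun a c h =>
  (sparseValue_sidon (a := a) (b := a) (c := c) (d := c) (by rw [h])).elim id id

/-- The Sidon property of the range of the sparse expansion. -/
theorem eq_or_eq_of_add_eq_add {a b c d : ℝ} (ha : a ∈ range sparseValue)
    (hb : b ∈ range sparseValue) (hc : c ∈ range sparseValue) (hd : d ∈ range sparseValue)
    (h : a + b = c + d) : a = c ∨ a = d := by
  obtain ⟨a, rfl⟩ := ha
  obtain ⟨b, rfl⟩ := hb
  obtain ⟨c, rfl⟩ := hc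
  obtain ⟨d, rfl⟩ := hd
  exact (sparseValue_sidon h).imp (congrArg _) (congrArg _)

/-! ### Hölder dependence of the dense value on the sparse value -/

/-- Comparison of the two expansions at the first level `k` where the sequences differ. -/
theorem exists_level_comparison {x y : DigitSeq} (hxy : x ≠ y) :
    ∃ k : ℕ, |denseValue x - denseValue y| ≤ 16 ^ (k + 1) * |sparseValue x - sparseValue y| ∧
      |sparseValue x - sparseValue y| ≤ (1 / 2) ^ (k ^ 2) := by
  classical
  have hex := Function.ne_iff.1 hxy
  let k := Nat.find hex
  have hk : x k ≠ y k := Nat.find_spec hex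
  have hlt : ∀ l < k, x l = y l := fun l hl => not_not.1 (Nat.find_min hex hl)
  set δ : ℝ := |(x k : ℝ) - y k| with hδ
  have hδ1 : 1 ≤ δ := by
    have h : ((x k : ℕ) : ℤ) - (y k : ℕ) ≠ 0 := fun h => hk (Fin.ext (by omega))
    have := Int.one_le_abs h
    rw [hδ]; exact_mod_cast this
  have hδN : δ ≤ 2 ^ (2 * k + 1) - 1 := abs_digit_sub_le k x y
  have hu := denseWeight_pos k
  have hs := sparseWeight_pos k
  have hdense : |denseValue x - denseValue y| ≤ 2 * δ * denseWeight k := by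
    have hS : HasSum (fun l => ((x l : ℝ) - y l) * denseWeight l)
        (denseValue x - denseValue y) := by
      simpa only [sub_mul] using (hasSum_denseValue x).sub (hasSum_denseValue y)
    have h := abs_sub_leading_term_le denseWeight_pos zero_le_one (fun l => ?_) hS (k := k)
      fun l hl => by rw [hlt l hl, sub_self]
    · have h' := abs_sub_abs_le_abs_sub (denseValue x - denseValue y)
        (((x k : ℝ) - y k) * denseWeight k)
      rw [abs_mul, abs_of_pos hu, ← hδ] at h'
      nlinarith
    · have h1 := radix_mul_denseWeight (l + 1)
      have h2 : denseWeight l = (1 / 2 : ℝ) ^ ((l + 1) ^ 2) := rfl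
      rw [← h2] at h1
      have := mul_le_mul_of_nonneg_right (abs_digit_sub_le (l + 1) x y)
        (denseWeight_pos (l + 1)).le
      linarith
  have hsparse : |(sparseValue x - sparseValue y) - 4 * ((x k : ℝ) - y k) * sparseWeight k| ≤
      23 / 15 * sparseWeight k := by
    have hS : HasSum (fun l => (sparseDigit l x - sparseDigit l y) * sparseWeight l)
        (sparseValue x - sparseValue y) := by
      simpa only [sub_mul] using (hasSum_sparseValue x).sub (hasSum_sparseValue y)
    -- the markers at level `k` depend on earlier digits only, so they cancel
    have hk' : sparseDigit k x - sparseDigit k y = 4 * ((x k : ℝ) - y k) := by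
      simp only [sparseDigit, marker_congr hlt]; ring
    have h := abs_sub_leading_sparse_le (fun l => ?_) hS (k := k) fun l hl => by
      simp only [sparseDigit, hlt l hl, marker_congr fun i hi => hlt i (hi.trans hl), sub_self]
    · rw [hk'] at h
      linarith
    · have := sparseDigit_le l x
      have := sparseDigit_le l y
      have := sparseDigit_nonneg l x
      have := sparseDigit_nonneg l y
      have : (0 : ℝ) < 2 ^ (2 * l + 1) := by positivity
      rw [abs_le]; constructor <;> linarith
  have habs : |4 * ((x k : ℝ) - y k) * sparseWeight k| = 4 * δ * sparseWeight k := by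
    rw [abs_mul, abs_mul, abs_of_pos hs, ← hδ, abs_of_pos (by norm_num : (0 : ℝ) < 4)]
  refine ⟨k, ?_, ?_⟩
  · have h' := abs_sub_abs_le_abs_sub (4 * ((x k : ℝ) - y k) * sparseWeight k)
      (sparseValue x - sparseValue y)
    rw [habs, abs_sub_comm (4 * _ * _)] at h'
    have hlow : 2 * δ * sparseWeight k ≤ |sparseValue x - sparseValue y| := by nlinarith
    calc |denseValue x - denseValue y| ≤ 2 * δ * denseWeight k := hdense
      _ = 16 ^ (k + 1) * (2 * δ * sparseWeight k) := by
          rw [denseWeight_eq_mul_sparseWeight]; ring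
      _ ≤ _ := mul_le_mul_of_nonneg_left hlow (by positivity)
  · have h' := abs_sub_abs_le_abs_sub (sparseValue x - sparseValue y)
      (4 * ((x k : ℝ) - y k) * sparseWeight k)
    rw [habs] at h'
    have h1 : δ * sparseWeight k ≤ 2 ^ (2 * k + 1) * sparseWeight k :=
      mul_le_mul_of_nonneg_right (by linarith) hs.le
    calc |sparseValue x - sparseValue y| ≤ 16 * 2 ^ (2 * k + 1) * sparseWeight k := by nlinarith
      _ = (1 / 2) ^ (k ^ 2 + 4 * k) := radix_mul_sparseWeight k
      _ ≤ (1 / 2) ^ (k ^ 2) :=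
          pow_le_pow_of_le_one (by norm_num) (by norm_num) (Nat.le_add_right _ _)

/-- The dense value depends on the sparse value in a Hölder way, for every exponent below one: the
loss `16 ^ (k + 1)` at level `k` is outweighed by any positive power of the scale
`2 ^ (- k ^ 2)`. -/
theorem exists_holder_bound {r : ℝ} (hr : r < 1) :
    ∃ C : ℝ≥0, ∀ x y : DigitSeq,
      |denseValue x - denseValue y| ≤ C * |sparseValue x - sparseValue y| ^ r := by
  set ε := 1 - r with hε
  have hε0 : 0 < ε := by linarith
  refine ⟨16 * (2 : ℝ≥0) ^ (4 / ε), fun x y => ?_⟩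
  rcases eq_or_ne x y with rfl | hxy
  · rw [sub_self, abs_zero]; positivity
  obtain ⟨k, h1, h2⟩ := exists_level_comparison hxy
  set g := |sparseValue x - sparseValue y| with hg
  have hg0 : 0 < g := abs_pos.2 (sub_ne_zero.2 (sparseValue_injective.ne hxy))
  have hsplit : g = g ^ ε * g ^ r := by
    rw [← Real.rpow_add hg0, hε, sub_add_cancel, Real.rpow_one]
  have hpow : (16 : ℝ) ^ k * g ^ ε ≤ 2 ^ (4 / ε) := by
    have h3 : g ^ ε ≤ (2 : ℝ) ^ (-(ε * (k : ℝ) ^ 2)) := by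
      refine (Real.rpow_le_rpow hg0.le h2 hε0.le).trans_eq ?_
      rw [one_div, inv_pow, ← Real.rpow_natCast 2 (k ^ 2), ← Real.rpow_neg zero_le_two,
        ← Real.rpow_mul zero_le_two]
      push_cast; ring_nf
    have h4 : (16 : ℝ) ^ k = 2 ^ (4 * (k : ℝ)) := by
      rw [Real.rpow_mul zero_le_two, Real.rpow_natCast]; norm_num
    rw [h4]
    refine (mul_le_mul_of_nonneg_left h3 (by positivity)).trans ?_
    rw [← Real.rpow_add two_pos]
    refine Real.rpow_le_rpow_of_exponent_le one_le_two ?_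
    -- completing the square in `k`
    rw [le_div_iff₀ hε0]
    nlinarith [sq_nonneg (ε * k - 2)]
  calc |denseValue x - denseValue y| ≤ 16 ^ (k + 1) * g := h1
    _ = 16 * (16 ^ k * g ^ ε) * g ^ r := by
        conv_lhs => rw [hsplit]
        ring
    _ ≤ 16 * 2 ^ (4 / ε) * g ^ r := by gcongr
    _ = _ := by push_cast; rfl

/-- Every number of `[0, 1)` has a mixed-radix expansion. -/
theorem Ico_subset_range_denseValue : Ico (0 : ℝ) 1 ⊆ range denseValue := by
  rintro y ⟨hy0, hy1⟩
  let n : ℕ → ℕ := fun k => ⌊y * 2 ^ (k ^ 2)⌋₊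
  let x : DigitSeq := fun k => ⟨n (k + 1) % 2 ^ (2 * k + 1), Nat.mod_lt _ (by positivity)⟩
  have hdiv : ∀ k, n (k + 1) / 2 ^ (2 * k + 1) = n k := fun k => by
    have h := Nat.floor_div_natCast (y * 2 ^ ((k + 1) ^ 2)) (2 ^ (2 * k + 1))
    rw [← h]
    simp only [n]
    congr 1
    rw [show (k + 1) ^ 2 = k ^ 2 + (2 * k + 1) by ring, pow_add]
    push_cast
    field_simp
  have hsum : ∀ m, ∑ k ∈ Finset.range m, (x k : ℝ) * denseWeight k =
      n m * (1 / 2) ^ (m ^ 2) := fun m => by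
    induction m with
    | zero => simp [n, Nat.floor_eq_zero.2 hy1]
    | succ m ih =>
      have h : n m * 2 ^ (2 * m + 1) + (x m : ℕ) = n (m + 1) := by
        rw [← hdiv m]; exact Nat.div_add_mod' _ _
      have h' : (n (m + 1) : ℝ) = n m * 2 ^ (2 * m + 1) + (x m : ℕ) := by exact_mod_cast h.symm
      rw [Finset.sum_range_succ, ih, h', ← radix_mul_denseWeight]
      change _ = _ * denseWeight m
      ring
  refine ⟨x, tendsto_nhds_unique (hasSum_denseValue x).tendsto_sum_nat ?_⟩
  simp only [hsum]
  have hatTop : Tendsto (fun m : ℕ => (2 : ℝ) ^ (m ^ 2)) atTop atTop :=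
    (tendsto_pow_atTop_atTop_of_one_lt one_lt_two).comp (tendsto_pow_atTop two_ne_zero)
  refine ((tendsto_nat_floor_mul_div_atTop hy0).comp hatTop).congr fun m => ?_
  simp [n, div_eq_mul_inv]

/-! ### The planar set and its dimension -/

/-- The square of the compact Sidon set, as a subset of the Euclidean plane. -/
def sidonSquare : Set (EuclideanSpace ℝ (Fin 2)) := {p | ∀ i, p i ∈ range sparseValue}

theorem sidonSquare_eq_preimage :
    sidonSquare = EuclideanSpace.equiv (Fin 2) ℝ ⁻¹' univ.pi fun _ => range sparseValue := by
  ext p; simp [sidonSquare]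

theorem isCompact_sidonSquare : IsCompact sidonSquare := by
  rw [sidonSquare_eq_preimage]
  exact (EuclideanSpace.equiv (Fin 2) ℝ).toHomeomorph.isCompact_preimage.2
    (isCompact_univ_pi fun _ => isCompact_range continuous_sparseValue)

theorem sidonSquare_nonempty : sidonSquare.Nonempty :=
  ⟨WithLp.toLp 2 fun _ => sparseValue fun _ => 0, fun _ => mem_range_self _⟩

/-- The coordinatewise passage from sparse to dense values is Hölder of every exponent `r < 1` and
maps the square of the Sidon set onto a set containing the open unit square. -/
theorem two_mul_le_dimH_pi {r : ℝ≥0} (hr0 : 0 < r) (hr : r < 1) :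
    2 * (r : ℝ≥0∞) ≤ dimH (univ.pi fun _ : Fin 2 => range sparseValue) := by
  let F : (Fin 2 → ℝ) → Fin 2 → ℝ := fun p i => denseValue (Function.invFun sparseValue (p i))
  have hF : ∀ x, denseValue (Function.invFun sparseValue (sparseValue x)) = denseValue x :=
    fun x => by rw [Function.leftInverse_invFun sparseValue_injective x]
  obtain ⟨C, hC⟩ := exists_holder_bound (r := r) (by exact_mod_cast hr)
  have hHolder : HolderOnWith C r F (univ.pi fun _ : Fin 2 => range sparseValue) := by
    intro p hp q hq
    refine edist_pi_le_iff.2 fun i => ?_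
    have hle : edist (p i) (q i) ≤ edist p q := edist_le_pi_edist p q i
    refine le_trans ?_ (mul_le_mul_right (ENNReal.rpow_le_rpow hle r.coe_nonneg) (C : ℝ≥0∞))
    obtain ⟨x, hx⟩ := hp i (mem_univ i)
    obtain ⟨y, hy⟩ := hq i (mem_univ i)
    simp only [F]
    rw [← hx, ← hy, hF, hF, edist_dist, edist_dist, Real.dist_eq, Real.dist_eq,
      ENNReal.ofReal_rpow_of_nonneg (abs_nonneg _) r.coe_nonneg, ← ENNReal.ofReal_coe_nnreal,
      ← ENNReal.ofReal_mul C.coe_nonneg]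
    exact ENNReal.ofReal_le_ofReal (hC x y)
  have hsub : (univ.pi fun _ : Fin 2 => Ioo (0 : ℝ) 1) ⊆
      F '' univ.pi fun _ : Fin 2 => range sparseValue := by
    intro z hz
    choose x hx using fun i => Ico_subset_range_denseValue (Ioo_subset_Ico_self (hz i (mem_univ i)))
    exact ⟨fun i => sparseValue (x i), fun i _ => mem_range_self _,
      funext fun i => (hF _).trans (hx i)⟩
  have hdim : dimH (univ.pi fun _ : Fin 2 => Ioo (0 : ℝ) 1) = 2 := by
    have hopen : IsOpen (univ.pi fun _ : Fin 2 => Ioo (0 : ℝ) 1) :=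
      isOpen_set_pi finite_univ fun _ _ => isOpen_Ioo
    rw [Real.dimH_of_nonempty_interior, Module.finrank_fin_fun, Nat.cast_ofNat]
    exact hopen.interior_eq.symm ▸ ⟨fun _ => 1 / 2, fun _ _ => by constructor <;> norm_num⟩
  have h := (dimH_mono hsub).trans (hHolder.dimH_image_le hr0)
  rw [hdim] at h
  exact ENNReal.mul_le_of_le_div h

theorem dimH_sidonSquare : dimH sidonSquare = 2 := by
  refine le_antisymm ?_ ?_
  · refine (dimH_mono (subset_univ _)).trans_eq ?_
    rw [Real.dimH_univ_eq_finrank, finrank_euclideanSpace_fin, Nat.cast_ofNat]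
  · rw [sidonSquare_eq_preimage, ContinuousLinearEquiv.dimH_preimage]
    set d := dimH (univ.pi fun _ : Fin 2 => range sparseValue) with hd
    by_contra! hlt
    have h1 : d / 2 < 1 := by
      rwa [ENNReal.div_lt_iff (by simp) (by simp), one_mul]
    obtain ⟨r, hr1, hr2⟩ := ENNReal.lt_iff_exists_nnreal_btwn.1 h1
    have hr0 : 0 < r := by exact_mod_cast (zero_le (a := d / 2)).trans_lt hr1
    have h := two_mul_le_dimH_pi hr0 (by exact_mod_cast hr2)
    rw [ENNReal.div_lt_iff (by simp) (by simp), mul_comm] at hr1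
    exact absurd h (not_le.2 hr1)

/-! ### No three points are shattered -/

/-- Two distinct points at equal distance from two distinct points of the plane form a rhombus with
them. -/
theorem add_eq_add_of_norm_sub_eq {p q y z : EuclideanSpace ℝ (Fin 2)} {t : ℝ} (hpq : p ≠ q)
    (hyz : y ≠ z) (hpy : ‖p - y‖ = t) (hqy : ‖q - y‖ = t) (hpz : ‖p - z‖ = t)
    (hqz : ‖q - z‖ = t) (i : Fin 2) : y i + z i = p i + q i := by
  have hsq : ∀ {u v : EuclideanSpace ℝ (Fin 2)}, ‖u - v‖ = t →
      (u 0 - v 0) ^ 2 + (u 1 - v 1) ^ 2 = t ^ 2 := fun {u v} h => by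
    rw [← h, EuclideanSpace.norm_sq_eq, Fin.sum_univ_two]
    simp
  have hpos : ∀ {u v : EuclideanSpace ℝ (Fin 2)}, u ≠ v →
      0 < (u 0 - v 0) ^ 2 + (u 1 - v 1) ^ 2 := fun {u v} h => by
    by_contra! hle
    refine h (PiLp.ext fun j => ?_)
    have h0 := sq_nonneg (u 0 - v 0)
    have h1 := sq_nonneg (u 1 - v 1)
    have h0' : (u 0 - v 0) ^ 2 = 0 := by linarith
    have h1' : (u 1 - v 1) ^ 2 = 0 := by linarith
    fin_cases j
    · exact sub_eq_zero.1 (pow_eq_zero_iff two_ne_zero |>.1 h0')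
    · exact sub_eq_zero.1 (pow_eq_zero_iff two_ne_zero |>.1 h1')
  have h1 := hsq hpy
  have h2 := hsq hqy
  have h3 := hsq hpz
  have h4 := hsq hqz
  have h5 := hpos hpq
  have h6 := hpos hyz
  -- the diagonals are orthogonal, and the defect `s` is orthogonal to both of them
  set a := p 0 - q 0
  set b := p 1 - q 1
  set c := y 0 - z 0
  set d := y 1 - z 1
  set s := y 0 + z 0 - p 0 - q 0 with hs
  set s' := y 1 + z 1 - p 1 - q 1 with hs'
  have e1 : a * c + b * d = 0 := by simp only [a, b, c, d]; linarith
  have e2 : s * a + s' * b = 0 := by simp only [a, b, hs, hs']; linarith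
  have e3 : s * c + s' * d = 0 := by simp only [c, d, hs, hs']; linarith
  have hdet : (a * d - b * c) ^ 2 ≠ 0 := by
    have : (a * d - b * c) ^ 2 = (a ^ 2 + b ^ 2) * (c ^ 2 + d ^ 2) - (a * c + b * d) ^ 2 := by
      ring
    rw [this, e1]
    have := mul_pos h5 h6
    simpa using this.ne'
  have hdet' : a * d - b * c ≠ 0 := fun h => hdet (by rw [h]; norm_num)
  have z1 : s = 0 := (mul_eq_zero.1 (by linear_combination d * e2 - b * e3 :
    s * (a * d - b * c) = 0)).resolve_right hdet'
  have z2 : s' = 0 := (mul_eq_zero.1 (by linear_combination a * e3 - c * e2 :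
    s' * (a * d - b * c) = 0)).resolve_right hdet'
  fin_cases i
  · change y 0 + z 0 = p 0 + q 0
    linarith
  · change y 1 + z 1 = p 1 + q 1
    linarith

/-- If three points of the Sidon square were shattered, the centre `y` of the circle through all
three would, by the rhombus and Sidon properties, share each coordinate with at least two of them,
and hence both coordinates with one of them. -/
theorem not_shatters_three {t : ℝ} (ht : 0 < t) (C : Finset sidonSquare) (hC : C.card = 3) :
    ¬ HypothesisShatters (sphereClass t sidonSquare) C := by
  classical
  intro h
  have hset : ∀ S : sidonSquare → Prop, ∃ y ∈ sidonSquare, ∀ x ∈ C,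
      (‖(x : EuclideanSpace ℝ (Fin 2)) - y‖ = t ↔ S x) := by
    intro S
    obtain ⟨_, ⟨y, hy, rfl⟩, hf⟩ := h fun x => if S x then 1 else 0
    refine ⟨y, hy, fun x hx => ?_⟩
    have := hf ⟨x, hx⟩
    unfold sphereIndicator at this
    by_cases hS : S x <;> by_cases hn : ‖(x : EuclideanSpace ℝ (Fin 2)) - y‖ = t <;>
      simp_all
  obtain ⟨y, hy, hall⟩ := hset fun _ => True
  simp only [iff_true] at hall
  have hpair : ∀ p ∈ C, ∀ q ∈ C, ∀ w ∈ C, p ≠ q → w ≠ p → w ≠ q → ∀ i,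
      y i = (p : EuclideanSpace ℝ (Fin 2)) i ∨ y i = (q : EuclideanSpace ℝ (Fin 2)) i := by
    intro p hp q hq w hw hpq hwp hwq i
    obtain ⟨z, hz, hzC⟩ := hset fun x => x ≠ w
    have hyz : y ≠ z := by
      rintro rfl
      exact (hzC w hw).1 (hall w hw) rfl
    exact eq_or_eq_of_add_eq_add (hy i) (hz i) (p.2 i) (q.2 i)
      (add_eq_add_of_norm_sub_eq (Subtype.coe_injective.ne hpq) hyz (hall p hp) (hall q hq)
        ((hzC p hp).2 hwp.symm) ((hzC q hq).2 hwq.symm) i)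
  have hne : ∀ p ∈ C, ¬ (y 0 = (p : EuclideanSpace ℝ (Fin 2)) 0 ∧
      y 1 = (p : EuclideanSpace ℝ (Fin 2)) 1) := by
    rintro p hp ⟨h0, h1⟩
    have hyp : (p : EuclideanSpace ℝ (Fin 2)) = y :=
      PiLp.ext fun j => by fin_cases j <;> [exact h0.symm; exact h1.symm]
    have := hall p hp
    rw [hyp, sub_self, norm_zero] at this
    exact ht.ne this
  obtain ⟨p, q, w, hpq, hpw, hqw, rfl⟩ := Finset.card_eq_three.1 hC
  have hp : p ∈ ({p, q, w} : Finset sidonSquare) := by simp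
  have hq : q ∈ ({p, q, w} : Finset sidonSquare) := by simp
  have hw : w ∈ ({p, q, w} : Finset sidonSquare) := by simp
  have a1 := hpair p hp q hq w hw hpq hpw.symm hqw.symm
  have a2 := hpair p hp w hw q hq hpw hpq.symm hqw
  have a3 := hpair q hq w hw p hp hqw hpq hpw
  -- in coordinate `0`, `y` agrees with two of the points; in coordinate `1`, with one of these two
  have np := hne p hp
  have nq := hne q hq
  have nw := hne w hw
  rcases a1 0 with h0 | h0
  · rcases a3 0 with h0' | h0'
    · exact (a1 1).elim (fun h1 => np ⟨h0, h1⟩) fun h1 => nq ⟨h0', h1⟩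
    · exact (a2 1).elim (fun h1 => np ⟨h0, h1⟩) fun h1 => nw ⟨h0', h1⟩
  · rcases a2 0 with h0' | h0'
    · exact (a1 1).elim (fun h1 => np ⟨h0', h1⟩) fun h1 => nq ⟨h0, h1⟩
    · exact (a3 1).elim (fun h1 => nq ⟨h0, h1⟩) fun h1 => nw ⟨h0', h1⟩

/-- A nonempty class shattering no set of three points has a VC-dimension, and it is at most
two. -/
theorem exists_isVCDimension_le_two {X : Type*} {H : Set (X → Fin 2)} (hH : H.Nonempty)
    (h3 : ∀ C : Finset X, C.card = 3 → ¬ HypothesisShatters H C) :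
    ∃ n, IsVCDimension H n ∧ n ≤ 2 := by
  by_cases h2 : ∃ C : Finset X, C.card = 2 ∧ HypothesisShatters H C
  · exact ⟨2, ⟨h2, h3⟩, le_rfl⟩
  push Not at h2
  by_cases h1 : ∃ C : Finset X, C.card = 1 ∧ HypothesisShatters H C
  · exact ⟨1, ⟨h1, h2⟩, one_le_two⟩
  push Not at h1
  obtain ⟨g, hg⟩ := hH
  exact ⟨0, ⟨⟨∅, rfl, fun f => ⟨g, hg, fun x => absurd x.2 (Finset.notMem_empty _)⟩⟩, h1⟩,
    zero_le⟩

theorem mainTheorem4 :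
    ∃ E : Set (EuclideanSpace ℝ (Fin 2)), IsCompact E ∧ dimH E = 2 ∧
      ∀ t : ℝ, 0 < t → ∃ n : ℕ, IsVCDimension (sphereClass t E) n ∧ n ≤ 2 := by
  refine ⟨sidonSquare, isCompact_sidonSquare, dimH_sidonSquare, fun t ht => ?_⟩
  obtain ⟨y, hy⟩ := sidonSquare_nonempty
  exact exists_isVCDimension_le_two ⟨_, y, hy, rfl⟩ (not_shatters_three ht)
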